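/- Let $m,n\ge 1$, let $M\in[0,1]^{m\times n}$ and let $\rho\in[0,1)$. Let $Y$ and $A$ be random $0$-$1$ matrices of size $m\times n$ such that the pairs $(Y_{ij},A_{ij})$ are mutually independent over $(i,j)$, $P(Y_{ij}=1)=M_{ij}$, $A_{ij}=1$ only if $Y_{ij}=1$, and $P(A_{ij}=1)=M_{ij}(1-\rho)$; that is, each $1$ of $Y$ is flipped to $0$ independently with probability $\rho$, and each $0$ of $Y$ stays $0$. Let $s$ be the number of $1$'s in $Y$. For $x\in\mathbb R$ put $$\tilde\ell(x,1)=\frac{(x-1)^2-\rho x^2}{1-\rho},\qquad \tilde\ell(x,0)=x^2,$$ and for $X\in\mathbb R^{m\times n}$ let $$\hat R_{\tilde\ell}(X)=\frac1{mn}\sum_{i,j}\tilde\ell(X_{ij},A_{ij}),\qquad E_A[R_{\tilde\ell}(X)]=E\Big[\frac1{mn}\sum_{i,j}\tilde\ell(X_{ij},A_{ij})\Big]$$ be the empirical and the expected error, the expectation being over the random matrix $A$. For $t\ge 0$ let $\mathcal X=\{X\in\mathbb R^{m\times n} : \|X\|_*\le t,\ 0\le X_{ij}\le 1 \text{ for all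 } i,j\}$, where $\|\cdot\|_*$ is the nuclear norm (the sum of the singular values). There is a universal constant $C>0$ (independent of $m,n,M,\rho,t,\delta$ and of the distribution) such that for every $\delta\in(0,1)$, with probability at least $1-\delta$, $$\sup_{X\in\mathcal X}\Big|E_A[R_{\tilde\ell}(X)]-\hat R_{\tilde\ell}(X)\Big|\ \le\ tC\,\frac{\sqrt n+\sqrt m+\sqrt[4]{s}}{(1-\rho)mn}+\frac{3\sqrt{\log(2/\delta)}}{\sqrt{mn}\,(1-\rho)} .$$ -/

import Mathlib

open MeasureTheory ProbabilityTheory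

namespace PUMatrix

noncomputable section

/-- The nuclear norm of a real matrix: the sum of its singular values, counted with multiplicity
(the singular values of the linear map `ℝⁿ → ℝᵐ` it defines between Euclidean spaces). -/
def nuclearNorm {m n : ℕ} (X : Matrix (Fin m) (Fin n) ℝ) : ℝ :=
  (Matrix.toEuclideanLin X).singularValues.sum (fun _ σ => σ)

/-- The hypothesis space: matrices with nuclear norm at most `t` and all entries in `[0, 1]`. -/
def hypothesisSpace (m n : ℕ) (t : ℝ) : Set (Matrix (Fin m) (Fin n) ℝ) :=
  {X | nuclearNorm X ≤ t ∧ ∀ i j, 0 ≤ X i j ∧ X i j ≤ 1}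

/-- The unbiased surrogate `ℓ̃(x, a)` of the squared loss, for a label `a ∈ {0, 1}`. -/
def shiftedLoss (ρ x a : ℝ) : ℝ :=
  if a = 1 then ((x - 1) ^ 2 - ρ * x ^ 2) / (1 - ρ) else x ^ 2

/-- The empirical error `(1 / mn) ∑ᵢⱼ ℓ̃(Xᵢⱼ, Aᵢⱼ)`. -/
def empiricalError {m n : ℕ} (ρ : ℝ) (X A : Matrix (Fin m) (Fin n) ℝ) : ℝ :=
  1 / ((m : ℝ) * (n : ℝ)) * ∑ i, ∑ j, shiftedLoss ρ (X i j) (A i j)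

/-- The expected error: the expectation of `(1 / mn) ∑ᵢⱼ ℓ̃(Xᵢⱼ, Aᵢⱼ)` over the random
observation matrix `A`, for a fixed matrix `X`. -/
def expectedError {Ω : Type*} [MeasurableSpace Ω] (μ : Measure Ω) {m n : ℕ} (ρ : ℝ)
    (A : Ω → Matrix (Fin m) (Fin n) ℝ) (X : Matrix (Fin m) (Fin n) ℝ) : ℝ :=
  ∫ ω, empiricalError ρ X (A ω) ∂μ

/-- The number of entries equal to `1` in a matrix. -/
def numOnes {m n : ℕ} (Y : Matrix (Fin m) (Fin n) ℝ) : ℕ :=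
  Nat.card {p : Fin m × Fin n // Y p.1 p.2 = 1}

/-- The non-deterministic positive-unlabeled observation model with parameter matrix `M` and
noise rate `ρ`. The clean matrix `Y` is a random 0-1 matrix with `P(Yᵢⱼ = 1) = Mᵢⱼ`.
The observed matrix `A` is a random 0-1 matrix whose ones form a subset of the ones of `Y`
(a one of `Y` may be flipped to `0`, a zero of `Y` is never flipped), and
`P(Aᵢⱼ = 1) = Mᵢⱼ (1 - ρ)`. The pairs `(Yᵢⱼ, Aᵢⱼ)` are mutually independent over `(i, j)`. -/
structure IsPUObservation {Ω : Type*} [MeasurableSpace Ω] (μ : Measure Ω) {m n : ℕ}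
    (M : Matrix (Fin m) (Fin n) ℝ) (ρ : ℝ) (Y A : Ω → Matrix (Fin m) (Fin n) ℝ) : Prop where
  measurable_clean : ∀ i j, Measurable fun ω => Y ω i j
  measurable_obs : ∀ i j, Measurable fun ω => A ω i j
  clean_zero_or_one : ∀ ω i j, Y ω i j = 0 ∨ Y ω i j = 1
  obs_zero_or_one : ∀ ω i j, A ω i j = 0 ∨ A ω i j = 1
  clean_of_obs : ∀ ω i j, A ω i j = 1 → Y ω i j = 1
  prob_clean : ∀ i j, μ.real {ω | Y ω i j = 1} = M i j
  prob_obs : ∀ i j, μ.real {ω | A ω i j = 1} = M i j * (1 - ρ)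
  indep : iIndepFun (fun (p : Fin m × Fin n) ω => (Y ω p.1 p.2, A ω p.1 p.2)) μ

end

end PUMatrix

/-! The shifted loss is affine in the indicator of a one, so the expected minus the empirical error
is `1 / ((1 - ρ) mn)` times `∑ (1 - 2 Xᵢⱼ) (pᵢⱼ - aᵢⱼ)`, where `pᵢⱼ = Mᵢⱼ (1 - ρ)` and `a` is the
pattern of ones of `A`. This pattern has a product Bernoulli law, so everything reduces to finite
weighted sums (`bernExp`).

As `|1 - 2 Xᵢⱼ| ≤ 1`, flipping one entry moves the supremum over `X` by at most 1, and the bounded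
differences inequality (`sum_bernWeight_tail_le`) keeps it within `ε = √(mn log (2/δ))` of its mean.

The mean is bounded by splitting `1 - 2X` (`supError_le`). The constant part costs at most `√(mn)`.
The part in `X` is at most `2t` times the operator norm of the centered matrix, by duality of the
nuclear and operator norms; a net argument bounds the expectation of that norm by `9 (√n + √m)`
(`bernExp_opNorm_le`). Entries being bounded, no fourth-root term is needed: the one in the theorem
is only a nonnegative surplus. -/

namespace PUMatrix

/-! ### Hoeffding's lemma and expectations under product Bernoulli laws -/

/-- Hoeffding's lemma for a two-point distribution. -/
lemma two_point_exp_le {p : ℝ} (hp0 : 0 ≤ p) (hp1 : p ≤ 1) (x y : ℝ) :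
    p * Real.exp x + (1 - p) * Real.exp y
      ≤ Real.exp (p * x + (1 - p) * y + (x - y) ^ 2 / 8) := by
  let μ : Measure Bool :=
    ENNReal.ofReal p • Measure.dirac true + ENNReal.ofReal (1 - p) • Measure.dirac false
  have hμ : IsProbabilityMeasure μ := ⟨by
    simp only [μ, Measure.add_apply, Measure.smul_apply, measure_univ, smul_eq_mul, mul_one]
    rw [← ENNReal.ofReal_add hp0 (by linarith)]; simp⟩
  have hint : ∀ f : Bool → ℝ, ∫ b, f b ∂μ = p * f true + (1 - p) * f false := by
    intro f
    rw [integral_add_measure (Integrable.smul_measure (by simp) (by simp))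
      (Integrable.smul_measure (by simp) (by simp))]
    simp [ENNReal.toReal_ofReal hp0, ENNReal.toReal_ofReal (sub_nonneg.2 hp1)]
  have key := (hasSubgaussianMGF_of_mem_Icc (μ := μ) (X := fun b => if b then x else y)
    (a := min x y) (b := max x y) (by fun_prop)
    (Filter.Eventually.of_forall (by intro b; cases b <;> simp))).mgf_le 1
  rw [mgf, hint, hint] at key
  simp only [if_true, Bool.false_eq_true, if_false, one_mul, NNReal.coe_pow, NNReal.coe_div,
    coe_nnnorm, NNReal.coe_ofNat, Real.norm_eq_abs, max_sub_min_eq_abs, abs_abs, one_pow,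
    mul_one, div_pow, sq_abs] at key
  have h1 : Real.exp x = Real.exp (x - (p * x + (1 - p) * y)) * Real.exp (p * x + (1 - p) * y) := by
    rw [← Real.exp_add]; ring_nf
  have h2 : Real.exp y = Real.exp (y - (p * x + (1 - p) * y)) * Real.exp (p * x + (1 - p) * y) := by
    rw [← Real.exp_add]; ring_nf
  calc p * Real.exp x + (1 - p) * Real.exp y
      = (p * Real.exp (x - (p * x + (1 - p) * y)) + (1 - p) * Real.exp (y - (p * x + (1 - p) * y)))
          * Real.exp (p * x + (1 - p) * y) := by rw [h1, h2]; ring_nf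
    _ ≤ Real.exp ((y - x) ^ 2 / 2 ^ 2 / 2) * Real.exp (p * x + (1 - p) * y) := by gcongr
    _ = _ := by rw [← Real.exp_add]; ring_nf

section Bernoulli

variable {ι : Type*} [Fintype ι]

/-- The probability of the pattern `a` under the product of Bernoulli laws with parameters `p`. -/
noncomputable def bernWeight (p : ι → ℝ) (a : ι → Bool) : ℝ :=
  ∏ i, if a i then p i else 1 - p i

/-- The expectation of `f` under the product of Bernoulli laws with parameters `p`. -/
noncomputable def bernExp [DecidableEq ι] (p : ι → ℝ) (f : (ι → Bool) → ℝ) : ℝ :=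
  ∑ a, bernWeight p a * f a

lemma bernWeight_nonneg {p : ι → ℝ} (h0 : ∀ i, 0 ≤ p i) (h1 : ∀ i, p i ≤ 1) (a : ι → Bool) :
    0 ≤ bernWeight p a :=
  Finset.prod_nonneg fun i _ => by split_ifs <;> linarith [h0 i, h1 i]

variable [DecidableEq ι]

lemma bernExp_mono {p : ι → ℝ} (h0 : ∀ i, 0 ≤ p i) (h1 : ∀ i, p i ≤ 1)
    {f g : (ι → Bool) → ℝ} (h : ∀ a, f a ≤ g a) : bernExp p f ≤ bernExp p g :=
  Finset.sum_le_sum fun a _ => mul_le_mul_of_nonneg_left (h a) (bernWeight_nonneg h0 h1 a)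

lemma bernExp_add (p : ι → ℝ) (f g : (ι → Bool) → ℝ) :
    bernExp p (fun a => f a + g a) = bernExp p f + bernExp p g := by
  simp [bernExp, mul_add, Finset.sum_add_distrib]

lemma bernExp_const_mul (p : ι → ℝ) (c : ℝ) (f : (ι → Bool) → ℝ) :
    bernExp p (fun a => c * f a) = c * bernExp p f := by
  simp only [bernExp, Finset.mul_sum]
  exact Finset.sum_congr rfl fun a _ => by ring

lemma bernExp_sum {κ : Type*} (s : Finset κ) (p : ι → ℝ) (f : κ → (ι → Bool) → ℝ) :
    bernExp p (fun a => ∑ k ∈ s, f k a) = ∑ k ∈ s, bernExp p (f k) := by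
  simp only [bernExp, Finset.mul_sum]
  exact Finset.sum_comm

lemma bernExp_prod (p : ι → ℝ) (g : ι → Bool → ℝ) :
    bernExp p (fun a => ∏ i, g i (a i)) = ∏ i, (p i * g i true + (1 - p i) * g i false) := by
  have : ∀ i, p i * g i true + (1 - p i) * g i false
      = ∑ b ∈ (Finset.univ : Finset Bool), (if b then p i else 1 - p i) * g i b := by
    intro i; simp
  simp_rw [this]
  rw [Finset.prod_univ_sum]
  simp_rw [Finset.prod_mul_distrib]
  rw [Fintype.piFinset_univ, bernExp]
  rfl

lemma bernExp_const (p : ι → ℝ) (c : ℝ) : bernExp p (fun _ => c) = c := by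
  have := bernExp_prod p (fun _ _ => 1)
  simp only [Finset.prod_const_one, mul_one, add_sub_cancel] at this
  have h2 := bernExp_const_mul p c (fun _ => 1)
  rw [this] at h2
  simpa using h2

/-- Independence factors the expectation, and each factor is a centered two-point law of range `|d
i|`. -/
lemma bernExp_exp_linear_le {p : ι → ℝ} (h0 : ∀ i, 0 ≤ p i) (h1 : ∀ i, p i ≤ 1) (d : ι → ℝ) :
    bernExp p (fun a => Real.exp (∑ i, d i * ((if a i then 1 else 0) - p i)))
      ≤ Real.exp ((∑ i, d i ^ 2) / 8) := by
  simp_rw [Real.exp_sum]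
  rw [bernExp_prod p (fun i b => Real.exp (d i * ((if b then 1 else 0) - p i))),
    Finset.sum_div, Real.exp_sum]
  refine Finset.prod_le_prod (fun i _ => ?_) fun i _ => ?_
  · have := h0 i; have := sub_nonneg.2 (h1 i); positivity
  · refine (two_point_exp_le (h0 i) (h1 i) _ _).trans_eq ?_
    congr 1
    simp
    ring

/-- If `E exp f ≤ exp c` then `E f ≤ c`. -/
lemma bernExp_le_of_exp_le {p : ι → ℝ} (h0 : ∀ i, 0 ≤ p i) (h1 : ∀ i, p i ≤ 1)
    {f : (ι → Bool) → ℝ} {c : ℝ} (h : bernExp p (fun a => Real.exp (f a)) ≤ Real.exp c) :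
    bernExp p f ≤ c := by
  -- Jensen's inequality by the tangent line: `f - c + 1 ≤ exp (f - c)`.
  have h2 : bernExp p f ≤ bernExp p (fun a => Real.exp (-c) * Real.exp (f a) + (c - 1)) := by
    refine bernExp_mono h0 h1 fun a => ?_
    rw [← Real.exp_add]
    linarith [Real.add_one_le_exp (-c + f a)]
  rw [bernExp_add, bernExp_const_mul, bernExp_const] at h2
  have h3 := mul_le_mul_of_nonneg_left h (Real.exp_pos (-c)).le
  rw [← Real.exp_add, neg_add_cancel, Real.exp_zero] at h3
  linarith

lemma bernExp_comp_equiv {κ : Type*} [Fintype κ] [DecidableEq κ] (e : ι ≃ κ) (p : κ → ℝ)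
    (f : (κ → Bool) → ℝ) :
    bernExp (p ∘ e) (fun a => f (a ∘ e.symm)) = bernExp p f := by
  refine Fintype.sum_equiv (e.arrowCongr (Equiv.refl Bool)) _ _ fun a => ?_
  have : bernWeight (p ∘ e) a = bernWeight p (a ∘ e.symm) :=
    Fintype.prod_equiv e _ _ fun i => by simp
  rw [this]
  rfl

end Bernoulli

/-! ### Bounded differences -/

/-- Changing the coordinate `i` changes `f` by at most `c i`. -/
def HasBoundedDifferences {ι : Type*} (f : (ι → Bool) → ℝ) (c : ι → ℝ) : Prop :=
  ∀ i a b, (∀ j, j ≠ i → a j = b j) → |f a - f b| ≤ c i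

lemma bernExp_succ {N : ℕ} (p : Fin (N + 1) → ℝ) (f : (Fin (N + 1) → Bool) → ℝ) :
    bernExp p f = bernExp (fun i => p i.succ) fun a =>
      p 0 * f (Fin.cons true a) + (1 - p 0) * f (Fin.cons false a) := by
  rw [bernExp, ← (Fin.consEquiv fun _ => Bool).sum_comp, Fintype.sum_prod_type_right, bernExp]
  refine Finset.sum_congr rfl fun a _ => ?_
  simp [bernWeight, Fin.prod_univ_succ, Fin.consEquiv]
  ring

lemma bernExp_exp_le_fin : ∀ {N : ℕ} {p : Fin N → ℝ} (_ : ∀ i, 0 ≤ p i) (_ : ∀ i, p i ≤ 1)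
    {f : (Fin N → Bool) → ℝ} {c : Fin N → ℝ} (_ : HasBoundedDifferences f c),
    bernExp p (fun a => Real.exp (f a)) ≤ Real.exp (bernExp p f + (∑ i, c i ^ 2) / 8) := by
  intro N
  induction N with
  | zero => intro p h0 h1 f c hf; simp [bernExp, bernWeight]
  | succ N ih =>
    intro p h0 h1 f c hf
    rw [bernExp_succ, bernExp_succ p f, Fin.sum_univ_succ]
    -- Averaging out the first coordinate preserves the other bounded differences; that coordinate
    -- alone costs `c 0 ^ 2 / 8`.
    set g : (Fin N → Bool) → ℝ := fun a =>
      p 0 * f (Fin.cons true a) + (1 - p 0) * f (Fin.cons false a) with hg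
    have hgb : HasBoundedDifferences g (fun i => c i.succ) := by
      intro i a b hab
      have hb : ∀ s : Bool, |f (Fin.cons s a) - f (Fin.cons s b)| ≤ c i.succ := by
        intro s
        refine hf i.succ _ _ fun j => ?_
        refine Fin.cases (by simp) (fun k hk => ?_) j
        simpa using hab k fun h => hk (by rw [h])
      have h2 := abs_le.1 (hb true)
      have h3 := abs_le.1 (hb false)
      have := h0 0
      have := h1 0
      rw [abs_le, hg]
      constructor <;> nlinarith
    have hstep : ∀ a : Fin N → Bool,
        p 0 * Real.exp (f (Fin.cons true a)) + (1 - p 0) * Real.exp (f (Fin.cons false a))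
          ≤ Real.exp (c 0 ^ 2 / 8) * Real.exp (g a) := by
      intro a
      refine (two_point_exp_le (h0 0) (h1 0) _ _).trans ?_
      rw [← Real.exp_add, add_comm]
      refine Real.exp_le_exp.2 (add_le_add_left (div_le_div_of_nonneg_right ?_ (by norm_num)) _)
      refine sq_le_sq' (abs_le.1 ?_).1 (abs_le.1 ?_).2 <;>
      · refine hf 0 _ _ fun j => ?_
        refine Fin.cases (by simp) (fun k _ => by simp) j
    refine (bernExp_mono (fun i => h0 i.succ) (fun i => h1 i.succ) hstep).trans ?_
    rw [bernExp_const_mul]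
    refine (mul_le_mul_of_nonneg_left (ih (fun i => h0 i.succ) (fun i => h1 i.succ) hgb)
      (Real.exp_pos _).le).trans_eq ?_
    rw [← Real.exp_add]
    congr 1
    ring

/-- The bounded differences inequality, at the level of the moment generating function. -/
lemma bernExp_exp_le {ι : Type*} [Fintype ι] [DecidableEq ι] {p : ι → ℝ} (h0 : ∀ i, 0 ≤ p i)
    (h1 : ∀ i, p i ≤ 1) {f : (ι → Bool) → ℝ} {c : ι → ℝ} (hf : HasBoundedDifferences f c) :
    bernExp p (fun a => Real.exp (f a)) ≤ Real.exp (bernExp p f + (∑ i, c i ^ 2) / 8) := by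
  let e := (Fintype.equivFin ι).symm
  rw [← bernExp_comp_equiv e, ← bernExp_comp_equiv e p f, ← e.sum_comp]
  refine bernExp_exp_le_fin (fun i => h0 _) (fun i => h1 _) (c := fun i => c (e i)) ?_
  intro i a b hab
  refine hf _ _ _ fun j hj => hab _ fun h => hj ?_
  rw [← h, e.apply_symm_apply]

/-! ### Nets and operator norms -/

/-- The closed unit ball of a `d`-dimensional space has a `1 / 2`-net of at most `5 ^ d` points. -/
lemma exists_half_net (E : Type*) [NormedAddCommGroup E] [NormedSpace ℝ E]
    [FiniteDimensional ℝ E] :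
    ∃ N : Finset E, (∀ v ∈ N, ‖v‖ ≤ 1) ∧ (∀ x : E, ‖x‖ ≤ 1 → ∃ v ∈ N, ‖x - v‖ ≤ 1 / 2) ∧
      N.card ≤ 5 ^ Module.finrank ℝ E := by
  classical
  let P : Finset E → Prop := fun s =>
    (∀ v ∈ s, ‖v‖ ≤ 1) ∧ ∀ v ∈ s, ∀ w ∈ s, v ≠ w → 1 / 2 ≤ ‖v - w‖
  have hcard : ∀ s, P s → s.card ≤ 5 ^ Module.finrank ℝ E := by
    rintro s ⟨h1, h2⟩
    -- Doubling turns `1 / 2`-separated points of the unit ball into 1-separated points of the ball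
    -- of radius 2, of which there are at most `5 ^ d`.
    have hinj : Function.Injective fun v : E => (2 : ℝ) • v :=
      smul_right_injective E two_ne_zero
    rw [← Finset.card_image_of_injective s hinj]
    refine Besicovitch.card_le_of_separated _ ?_ ?_
    · intro c hc
      obtain ⟨v, hv, rfl⟩ := Finset.mem_image.1 hc
      rw [norm_smul]
      have := h1 v hv
      norm_num
      linarith
    · intro c hc d hd hcd
      obtain ⟨v, hv, rfl⟩ := Finset.mem_image.1 hc
      obtain ⟨w, hw, rfl⟩ := Finset.mem_image.1 hd
      have := h2 v hv w hw fun h => hcd (by rw [h])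
      rw [← smul_sub, norm_smul]
      norm_num
      linarith
  -- A separated set of maximal cardinality is a net: a point far from it could be added.
  obtain ⟨k, ⟨s, hs, rfl⟩, hmax⟩ : ∃ k ∈ {k | ∃ s, P s ∧ s.card = k},
      ∀ l ∈ {k | ∃ s, P s ∧ s.card = k}, l ≤ k := by
    have hne : {k | ∃ s, P s ∧ s.card = k}.Nonempty := ⟨0, ∅, by simp [P], rfl⟩
    have hb : BddAbove {k | ∃ s, P s ∧ s.card = k} :=
      ⟨5 ^ Module.finrank ℝ E, by rintro k ⟨s, hs, rfl⟩; exact hcard s hs⟩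
    exact ⟨sSup _, Nat.sSup_mem hne hb, fun l hl => le_csSup hb hl⟩
  refine ⟨s, hs.1, fun x hx => ?_, hcard s hs⟩
  by_contra! hfar
  have hxs : x ∉ s := fun h => by
    have := hfar x h
    norm_num at this
  have hP : P (insert x s) := by
    refine ⟨?_, ?_⟩
    · simpa [hx] using hs.1
    · intro v hv w hw hvw
      rcases Finset.mem_insert.1 hv with rfl | hv
      · rcases Finset.mem_insert.1 hw with rfl | hw
        · exact absurd rfl hvw
        · exact (hfar w hw).le
      · rcases Finset.mem_insert.1 hw with hwx | hw
        · rw [norm_sub_rev, hwx]; exact (hfar v hv).le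
        · exact hs.2 v hv w hw hvw
  have := hmax _ ⟨_, hP, rfl⟩
  rw [Finset.card_insert_of_notMem hxs] at this
  omega

lemma exists_norm_le_two_mul_inner {F : Type*} [NormedAddCommGroup F] [InnerProductSpace ℝ F]
    {N : Finset F} (hN : ∀ x : F, ‖x‖ ≤ 1 → ∃ v ∈ N, ‖x - v‖ ≤ 1 / 2) (w : F) :
    ∃ u ∈ N, ‖w‖ ≤ 2 * inner ℝ u w := by
  by_cases hw : w = 0
  · obtain ⟨u, hu, -⟩ := hN 0 (by simp)
    exact ⟨u, hu, by simp [hw]⟩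
  have hw' : 0 < ‖w‖ := norm_pos_iff.2 hw
  obtain ⟨u, hu, hd⟩ := hN (‖w‖⁻¹ • w) (by rw [norm_smul, norm_inv, norm_norm,
    inv_mul_cancel₀ hw'.ne'])
  refine ⟨u, hu, ?_⟩
  have h1 : inner ℝ (‖w‖⁻¹ • w) w = ‖w‖ := by
    rw [real_inner_smul_left, real_inner_self_eq_norm_sq]
    field_simp
  have h2 := real_inner_le_norm (‖w‖⁻¹ • w - u) w
  rw [inner_sub_left, h1] at h2
  nlinarith

lemma exists_opNorm_le_two_mul {E F : Type*} [NormedAddCommGroup E] [NormedSpace ℝ E]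
    [NormedAddCommGroup F] [NormedSpace ℝ F]
    {N : Finset E} (hN : ∀ x : E, ‖x‖ ≤ 1 → ∃ v ∈ N, ‖x - v‖ ≤ 1 / 2) (B : E →L[ℝ] F) :
    ∃ v ∈ N, ‖B‖ ≤ 2 * ‖B v‖ := by
  obtain ⟨v₀, hv₀, -⟩ := hN 0 (by simp)
  obtain ⟨v, hv, hmax⟩ := N.exists_max_image (fun v => ‖B v‖) ⟨v₀, hv₀⟩
  refine ⟨v, hv, ?_⟩
  -- Replacing a unit vector by a net point costs at most `‖B‖ / 2`, absorbed on the left.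
  have : ‖B‖ ≤ ‖B v‖ + ‖B‖ / 2 := by
    refine ContinuousLinearMap.opNorm_le_of_unit_norm (by positivity) fun x hx => ?_
    obtain ⟨w, hw, hd⟩ := hN x hx.le
    calc ‖B x‖ = ‖B w + B (x - w)‖ := by rw [← map_add, add_sub_cancel]
      _ ≤ ‖B w‖ + ‖B (x - w)‖ := norm_add_le _ _
      _ ≤ ‖B v‖ + ‖B‖ * (1 / 2) :=
        add_le_add (hmax w hw) ((B.le_opNorm _).trans (by gcongr))
      _ = _ := by ring
  linarith

/-! ### Matrices as operators and nuclear norm duality -/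

/-- The operator of a real matrix between Euclidean spaces. -/
noncomputable def euclideanCLM {m n : ℕ} (B : Matrix (Fin m) (Fin n) ℝ) :
    EuclideanSpace ℝ (Fin n) →L[ℝ] EuclideanSpace ℝ (Fin m) :=
  (Matrix.toEuclideanLin B).toContinuousLinearMap

lemma inner_euclideanCLM {m n : ℕ} (B : Matrix (Fin m) (Fin n) ℝ)
    (u : EuclideanSpace ℝ (Fin m)) (v : EuclideanSpace ℝ (Fin n)) :
    inner ℝ u (euclideanCLM B v) = ∑ q : Fin m × Fin n, u q.1 * v q.2 * B q.1 q.2 := by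
  rw [Fintype.sum_prod_type, PiLp.inner_apply]
  refine Finset.sum_congr rfl fun i _ => ?_
  simp only [euclideanCLM, LinearMap.coe_toContinuousLinearMap', Matrix.toLpLin_apply,
    Matrix.mulVec, dotProduct]
  simp only [RCLike.inner_apply, conj_trivial, Finset.sum_mul]
  exact Finset.sum_congr rfl fun j _ => by ring

open Module in
/-- Duality of the nuclear norm and the operator norm. -/
lemma abs_sum_mul_le_nuclearNorm_mul {m n : ℕ} (X B : Matrix (Fin m) (Fin n) ℝ) :
    |∑ i, ∑ j, X i j * B i j| ≤ nuclearNorm X * ‖euclideanCLM B‖ := by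
  set T := Matrix.toEuclideanLin X with hT
  set S := Matrix.toEuclideanLin B with hS
  -- The pairing is the trace of `S* T`, so the standard basis may be exchanged for the right
  -- singular vectors of `T`.
  have hsum : ∀ b : OrthonormalBasis (Fin n) ℝ (EuclideanSpace ℝ (Fin n)),
      ((LinearMap.adjoint S) ∘ₗ T).trace ℝ _ = ∑ k, inner ℝ (S (b k)) (T (b k)) := by
    intro b
    rw [LinearMap.trace_eq_sum_inner _ b]
    simp [LinearMap.adjoint_inner_right]
  have hfr : finrank ℝ (EuclideanSpace ℝ (Fin n)) = n := by simp
  set v := T.isSymmetric_adjoint_comp_self.eigenvectorBasis hfr with hv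
  have hentry : ∑ i, ∑ j, X i j * B i j = ∑ k, inner ℝ (S (v k)) (T (v k)) := by
    rw [← hsum v, hsum (EuclideanSpace.basisFun (Fin n) ℝ), Finset.sum_comm]
    refine Finset.sum_congr rfl fun j _ => ?_
    rw [PiLp.inner_apply]
    refine Finset.sum_congr rfl fun i _ => ?_
    simp [hT, hS, Matrix.toLpLin_apply]
  have hnorm : ∀ k : Fin n, ‖T (v k)‖ = T.singularValues k := by
    intro k
    rw [← sq_eq_sq₀ (norm_nonneg _) (T.singularValues_nonneg _), T.sq_singularValues_fin hfr,
      ← real_inner_self_eq_norm_sq, ← LinearMap.adjoint_inner_right]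
    have := T.isSymmetric_adjoint_comp_self.apply_eigenvectorBasis hfr k
    simp only [LinearMap.comp_apply] at this
    rw [hv, this, inner_smul_right, real_inner_self_eq_norm_sq, OrthonormalBasis.norm_eq_one]
    simp
  -- The singular values are indexed by all of `ℕ` and vanish from index `n` on.
  have hnuc : nuclearNorm X = ∑ k : Fin n, T.singularValues k := by
    rw [nuclearNorm, Finsupp.sum, Fin.sum_univ_eq_sum_range (fun k => T.singularValues k) n]
    refine Finset.sum_subset (fun k hk => ?_) fun k _ hk =>
      Finsupp.notMem_support_iff.1 hk
    rw [Finset.mem_range]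
    by_contra! h
    exact Finsupp.mem_support_iff.1 hk (T.singularValues_of_finrank_le (by simpa using h))
  rw [hentry, hnuc, Finset.sum_mul]
  refine (Finset.abs_sum_le_sum_abs _ _).trans (Finset.sum_le_sum fun k _ => ?_)
  refine (abs_real_inner_le_norm _ _).trans ?_
  rw [hnorm, mul_comm]
  refine mul_le_mul_of_nonneg_left ?_ (T.singularValues_nonneg _)
  have := (euclideanCLM B).le_opNorm (v k)
  rwa [OrthonormalBasis.norm_eq_one, mul_one] at this

/-! ### Tail and expectation bounds -/

/-- The bounded differences tail inequality for unit differences. -/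
lemma sum_bernWeight_tail_le {ι : Type*} [Fintype ι] [DecidableEq ι] [Nonempty ι] {p : ι → ℝ}
    (h0 : ∀ i, 0 ≤ p i) (h1 : ∀ i, p i ≤ 1) {f : (ι → Bool) → ℝ}
    (hf : HasBoundedDifferences f fun _ => 1) {ε : ℝ} (hε : 0 ≤ ε) :
    ∑ a with ¬ f a ≤ bernExp p f + ε, bernWeight p a
      ≤ Real.exp (-(2 * ε ^ 2 / Fintype.card ι)) := by
  have hN : (0 : ℝ) < Fintype.card ι := by exact_mod_cast Fintype.card_pos
  set N : ℝ := (Fintype.card ι : ℝ) with hNdef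
  -- Minimizer of the Chernoff exponent `N r ^ 2 / 8 - r ε`.
  set r : ℝ := 4 * ε / N with hr
  have hr0 : 0 ≤ r := by positivity
  have hmgf := bernExp_exp_le h0 h1 (f := fun a => r * f a) (c := fun _ => r) (by
    intro i a b hab
    rw [← mul_sub, abs_mul, abs_of_nonneg hr0]
    exact mul_le_of_le_one_right hr0 (hf i a b hab))
  rw [bernExp_const_mul, Finset.sum_const, Finset.card_univ, nsmul_eq_mul, ← hNdef] at hmgf
  have hle : ∑ a with ¬ f a ≤ bernExp p f + ε, bernWeight p a
      ≤ bernExp p (fun a => Real.exp (-(r * (bernExp p f + ε))) * Real.exp (r * f a)) := by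
    refine (Finset.sum_le_sum fun a ha => ?_).trans (Finset.sum_le_sum_of_subset_of_nonneg
      (Finset.filter_subset _ _) fun a _ _ => mul_nonneg (bernWeight_nonneg h0 h1 a) ?_)
    · have ha' := (Finset.mem_filter.1 ha).2
      refine le_mul_of_one_le_right (bernWeight_nonneg h0 h1 a) ?_
      dsimp only
      rw [← Real.exp_add]
      refine Real.one_le_exp ?_
      have := mul_le_mul_of_nonneg_left (not_le.1 ha').le hr0
      linarith
    · positivity
  rw [bernExp_const_mul] at hle
  refine hle.trans ((mul_le_mul_of_nonneg_left hmgf (Real.exp_pos _).le).trans_eq ?_)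
  rw [← Real.exp_add]
  congr 1
  rw [hr]
  field_simp
  ring

/-- Exponential moments at `±2 / √N` replace a variance computation; they give `3 / 4 * √N`. -/
lemma bernExp_abs_sum_le {ι : Type*} [Fintype ι] [DecidableEq ι] [Nonempty ι] {p : ι → ℝ}
    (h0 : ∀ i, 0 ≤ p i) (h1 : ∀ i, p i ≤ 1) :
    bernExp p (fun a => |∑ i, ((if a i then 1 else 0) - p i)|) ≤ √(Fintype.card ι) := by
  have hN : (0 : ℝ) < Fintype.card ι := by exact_mod_cast Fintype.card_pos
  set N : ℝ := (Fintype.card ι : ℝ) with hNdef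
  have hs : 0 < √N := Real.sqrt_pos.2 hN
  have hlin : ∀ d : ℝ, d ^ 2 = 4 / N →
      bernExp p (fun a => Real.exp (∑ i, d * ((if a i then 1 else 0) - p i)))
        ≤ Real.exp (1 / 2) := by
    intro d hd
    refine (bernExp_exp_linear_le h0 h1 fun _ => d).trans_eq ?_
    rw [Finset.sum_const, Finset.card_univ, nsmul_eq_mul, ← hNdef, hd]
    congr 1
    field_simp
    norm_num
  have hsq : (2 / √N) ^ 2 = 4 / N := by rw [div_pow, Real.sq_sqrt hN.le]; norm_num
  have hexp : bernExp p (fun a => Real.exp (2 / √N * |∑ i, ((if a i then 1 else 0) - p i)|))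
      ≤ Real.exp (3 / 2) := by
    calc _ ≤ bernExp p (fun a => Real.exp (∑ i, 2 / √N * ((if a i then 1 else 0) - p i))
            + Real.exp (∑ i, -(2 / √N) * ((if a i then 1 else 0) - p i))) := by
          refine bernExp_mono h0 h1 fun a => ?_
          rw [← Finset.mul_sum, ← Finset.mul_sum]
          rcases abs_choice (∑ i, ((if a i then 1 else 0) - p i)) with h | h <;> rw [h]
          · linarith [Real.exp_pos (-(2 / √N) * ∑ i, ((if a i then 1 else 0) - p i))]
          · rw [mul_neg, neg_mul]
            linarith [Real.exp_pos (2 / √N * ∑ i, ((if a i then 1 else 0) - p i))]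
      _ ≤ Real.exp (1 / 2) + Real.exp (1 / 2) := by
          rw [bernExp_add]
          exact add_le_add (hlin _ hsq) (hlin _ (by rw [neg_sq, hsq]))
      _ ≤ Real.exp 1 * Real.exp (1 / 2) := by
          nlinarith [Real.add_one_le_exp 1, Real.exp_pos (1 / 2)]
      _ = _ := by rw [← Real.exp_add]; norm_num
  have := bernExp_le_of_exp_le h0 h1 hexp
  rw [bernExp_const_mul, div_mul_eq_mul_div, div_le_iff₀ hs] at this
  linarith

/-- The 0-1 matrix of a pattern, centered at the parameters `p`. -/
noncomputable def centeredMatrix {m n : ℕ} (p : Fin m × Fin n → ℝ) (a : Fin m × Fin n → Bool) :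
    Matrix (Fin m) (Fin n) ℝ :=
  Matrix.of fun i j => (if a (i, j) then 1 else 0) - p (i, j)

/-- The expected operator norm of a centered random 0-1 matrix with independent entries. -/
lemma bernExp_opNorm_le {m n : ℕ} (hm : 0 < m) {p : Fin m × Fin n → ℝ}
    (h0 : ∀ i, 0 ≤ p i) (h1 : ∀ i, p i ≤ 1) :
    bernExp p (fun a => ‖euclideanCLM (centeredMatrix p a)‖) ≤ 9 * (√n + √m) := by
  obtain ⟨U, hU1, hU, hUc⟩ := exists_half_net (EuclideanSpace ℝ (Fin m))
  obtain ⟨V, hV1, hV, hVc⟩ := exists_half_net (EuclideanSpace ℝ (Fin n))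
  have hmn : (0 : ℝ) < m + n := by positivity
  -- This scale balances the `5 ^ (m + n) ≤ exp (2 r ^ 2)` pairs of net points against the exponent
  -- `r ^ 2 / 8` of each. Two net approximations give `‖B‖ ≤ 4 ⟪u, B v⟫`, hence the factor `r / 4`
  -- below and a mean of at most `(17 / 2) r`.
  set r : ℝ := √(m + n) with hr
  have hr0 : 0 < r := Real.sqrt_pos.2 hmn
  have hr2 : r ^ 2 = m + n := Real.sq_sqrt hmn.le
  have hlin : ∀ u ∈ U, ∀ v ∈ V, bernExp p (fun a =>
      Real.exp (r * inner ℝ u (euclideanCLM (centeredMatrix p a) v))) ≤ Real.exp (r ^ 2 / 8) := by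
    intro u hu v hv
    have hE : ∀ a, r * inner ℝ u (euclideanCLM (centeredMatrix p a) v)
        = ∑ q : Fin m × Fin n, (r * (u q.1 * v q.2)) * ((if a q then 1 else 0) - p q) := by
      intro a
      rw [inner_euclideanCLM, Finset.mul_sum]
      refine Finset.sum_congr rfl fun q _ => ?_
      simp [centeredMatrix, mul_assoc]
    simp_rw [hE]
    refine (bernExp_exp_linear_le h0 h1 _).trans ?_
    have hs : ∑ q : Fin m × Fin n, (r * (u q.1 * v q.2)) ^ 2 = r ^ 2 * (‖u‖ ^ 2 * ‖v‖ ^ 2) := by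
      rw [EuclideanSpace.real_norm_sq_eq, EuclideanSpace.real_norm_sq_eq,
        Finset.sum_mul_sum, Finset.mul_sum, Fintype.sum_prod_type]
      refine Finset.sum_congr rfl fun i _ => ?_
      rw [Finset.mul_sum]
      exact Finset.sum_congr rfl fun j _ => by ring
    rw [hs]
    have hu' := pow_le_one₀ (norm_nonneg u) (hU1 u hu) (n := 2)
    have hv' := pow_le_one₀ (norm_nonneg v) (hV1 v hv) (n := 2)
    have : ‖u‖ ^ 2 * ‖v‖ ^ 2 ≤ 1 := mul_le_one₀ hu' (by positivity) hv'
    gcongr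
    exact mul_le_of_le_one_right (by positivity) this
  have hexp : bernExp p (fun a => Real.exp (r / 4 * ‖euclideanCLM (centeredMatrix p a)‖))
      ≤ Real.exp (2 * r ^ 2 + r ^ 2 / 8) := by
    calc _ ≤ bernExp p (fun a => ∑ z ∈ U ×ˢ V,
            Real.exp (r * inner ℝ z.1 (euclideanCLM (centeredMatrix p a) z.2))) := by
          refine bernExp_mono h0 h1 fun a => ?_
          obtain ⟨v, hv, hBv⟩ := exists_opNorm_le_two_mul hV (euclideanCLM (centeredMatrix p a))
          obtain ⟨u, hu, hBu⟩ :=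
            exists_norm_le_two_mul_inner hU (euclideanCLM (centeredMatrix p a) v)
          refine le_trans ?_ (Finset.single_le_sum (f := fun z : _ × _ =>
            Real.exp (r * inner ℝ z.1 (euclideanCLM (centeredMatrix p a) z.2)))
            (fun z _ => (Real.exp_pos _).le) (Finset.mk_mem_product hu hv))
          refine Real.exp_le_exp.2 ?_
          dsimp only
          nlinarith
      _ = ∑ z ∈ U ×ˢ V, bernExp p (fun a =>
            Real.exp (r * inner ℝ z.1 (euclideanCLM (centeredMatrix p a) z.2))) :=
          bernExp_sum _ _ _
      _ ≤ (U ×ˢ V).card • Real.exp (r ^ 2 / 8) :=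
          Finset.sum_le_card_nsmul _ _ _ fun z hz =>
            hlin _ (Finset.mem_product.1 hz).1 _ (Finset.mem_product.1 hz).2
      _ ≤ Real.exp (2 * r ^ 2) * Real.exp (r ^ 2 / 8) := by
          rw [nsmul_eq_mul]
          refine mul_le_mul_of_nonneg_right ?_ (Real.exp_pos _).le
          have hc : (U ×ˢ V).card ≤ 5 ^ (m + n) := by
            rw [Finset.card_product, pow_add]
            exact Nat.mul_le_mul (by simpa using hUc) (by simpa using hVc)
          have he : (5 : ℝ) ≤ Real.exp 2 := by
            have : Real.exp 2 = Real.exp 1 * Real.exp 1 := by rw [← Real.exp_add]; norm_num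
            rw [this]
            nlinarith [Real.exp_one_gt_d9]
          calc ((U ×ˢ V).card : ℝ) ≤ 5 ^ (m + n) := by exact_mod_cast hc
            _ ≤ Real.exp 2 ^ (m + n) := by gcongr
            _ = Real.exp (2 * r ^ 2) := by
              rw [← Real.exp_nat_mul, hr2]; push_cast; ring_nf
      _ = _ := by rw [← Real.exp_add]
  have h := bernExp_le_of_exp_le h0 h1 hexp
  rw [bernExp_const_mul] at h
  have hK : bernExp p (fun a => ‖euclideanCLM (centeredMatrix p a)‖) ≤ 9 * r := by
    refine le_of_mul_le_mul_left (h.trans ?_) (by positivity : 0 < r / 4)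
    nlinarith
  have hrle : r ≤ √n + √m := by
    rw [hr]
    refine Real.sqrt_le_iff.2 ⟨by positivity, ?_⟩
    nlinarith [Real.sq_sqrt (Nat.cast_nonneg (α := ℝ) m), Real.sq_sqrt (Nat.cast_nonneg (α := ℝ) n),
      Real.sqrt_nonneg (m : ℝ), Real.sqrt_nonneg (n : ℝ)]
  linarith

/-! ### Supremum of the empirical process -/

/-- The centered empirical process `∑ (1 - 2 Xᵢⱼ) (pᵢⱼ - aᵢⱼ)`. -/
noncomputable def centeredError {m n : ℕ} (p : Fin m × Fin n → ℝ) (X : Matrix (Fin m) (Fin n) ℝ)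
    (a : Fin m × Fin n → Bool) : ℝ :=
  ∑ q : Fin m × Fin n, (1 - 2 * X q.1 q.2) * (p q - (if a q then 1 else 0))

/-- The supremum of the centered empirical process over the hypothesis space. -/
noncomputable def supError {m n : ℕ} (p : Fin m × Fin n → ℝ) (t : ℝ) (a : Fin m × Fin n → Bool) :
    ℝ :=
  ⨆ X : hypothesisSpace m n t, |centeredError p X a|

section SupError

variable {m n : ℕ} {p : Fin m × Fin n → ℝ}

lemma abs_centeredError_sub_le {X : Matrix (Fin m) (Fin n) ℝ}
    (hX : ∀ i j, 0 ≤ X i j ∧ X i j ≤ 1) {q : Fin m × Fin n} {a b : Fin m × Fin n → Bool}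
    (hab : ∀ j, j ≠ q → a j = b j) :
    |centeredError p X a - centeredError p X b| ≤ 1 := by
  rw [centeredError, centeredError, ← Finset.sum_sub_distrib,
    Finset.sum_eq_single q (fun j _ hj => by rw [hab j hj, sub_self]) (by simp), ← mul_sub, abs_mul]
  have h := hX q.1 q.2
  refine mul_le_one₀ (abs_le.2 ⟨by linarith, by linarith⟩) (abs_nonneg _) ?_
  cases a q <;> cases b q <;> simp

/-- The point is boundedness of the family: an unbounded real supremum would be 0 by convention. -/
lemma abs_centeredError_le_supError (h0 : ∀ i, 0 ≤ p i) (h1 : ∀ i, p i ≤ 1) {t : ℝ}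
    {X : Matrix (Fin m) (Fin n) ℝ} (hX : X ∈ hypothesisSpace m n t) (a : Fin m × Fin n → Bool) :
    |centeredError p X a| ≤ supError p t a := by
  refine le_ciSup (f := fun X : hypothesisSpace m n t => |centeredError p X a|)
    ⟨∑ q : Fin m × Fin n, 1, ?_⟩ ⟨X, hX⟩
  rintro _ ⟨Z, rfl⟩
  refine (Finset.abs_sum_le_sum_abs _ _).trans (Finset.sum_le_sum fun q _ => ?_)
  have h := Z.2.2 q.1 q.2
  rw [abs_mul]
  refine mul_le_one₀ (abs_le.2 ⟨by linarith, by linarith⟩) (abs_nonneg _) ?_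
  have := h0 q
  have := h1 q
  split_ifs <;> exact abs_le.2 ⟨by linarith, by linarith⟩

lemma supError_nonneg (t : ℝ) (a : Fin m × Fin n → Bool) : 0 ≤ supError p t a :=
  Real.iSup_nonneg fun _ => abs_nonneg _

lemma hasBoundedDifferences_supError (h0 : ∀ i, 0 ≤ p i) (h1 : ∀ i, p i ≤ 1) (t : ℝ) :
    HasBoundedDifferences (supError p t) fun _ => 1 := by
  have hone : ∀ q (a b : Fin m × Fin n → Bool), (∀ j, j ≠ q → a j = b j) →
      supError p t a ≤ supError p t b + 1 := by
    intro q a b hab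
    refine Real.iSup_le (fun X => ?_) (by linarith [supError_nonneg (p := p) t b])
    have h2 := abs_centeredError_sub_le (p := p) X.2.2 hab
    have h3 := abs_centeredError_le_supError h0 h1 X.2 b
    have h4 := abs_sub_abs_le_abs_sub (centeredError p X.1 a) (centeredError p X.1 b)
    linarith
  intro q a b hab
  have h2 := hone q a b hab
  have h3 := hone q b a fun j hj => (hab j hj).symm
  exact abs_le.2 ⟨by linarith, by linarith⟩

/-- In `1 - 2X` the constant 1 pairs to the total sum, while `2X` is handled by nuclear norm
duality. -/
lemma supError_le {t : ℝ} (ht : 0 ≤ t) (a : Fin m × Fin n → Bool) :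
    supError p t a ≤ |∑ q, ((if a q then 1 else 0) - p q)|
      + 2 * t * ‖euclideanCLM (centeredMatrix p a)‖ := by
  refine Real.iSup_le (fun X => ?_) (by positivity)
  have hdec : centeredError p X.1 a = -(∑ q, ((if a q then 1 else 0) - p q))
      + 2 * ∑ i, ∑ j, X.1 i j * centeredMatrix p a i j := by
    rw [← Fintype.sum_prod_type' fun i j => X.1 i j * centeredMatrix p a i j,
      ← Finset.sum_neg_distrib, Finset.mul_sum, ← Finset.sum_add_distrib]
    refine Finset.sum_congr rfl fun q _ => ?_
    simp only [centeredMatrix, Matrix.of_apply]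
    ring
  have hdual := abs_sum_mul_le_nuclearNorm_mul X.1 (centeredMatrix p a)
  have hX := mul_le_mul_of_nonneg_right X.2.1 (norm_nonneg (euclideanCLM (centeredMatrix p a)))
  rw [hdec]
  refine (abs_add_le _ _).trans ?_
  rw [abs_neg, abs_mul, abs_two]
  linarith

lemma bernExp_supError_le (hm : 0 < m) (hn : 0 < n) (h0 : ∀ i, 0 ≤ p i) (h1 : ∀ i, p i ≤ 1)
    {t : ℝ} (ht : 0 ≤ t) :
    bernExp p (supError p t) ≤ √((m : ℝ) * n) + 18 * t * (√n + √m) := by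
  have : Nonempty (Fin m × Fin n) := ⟨(⟨0, hm⟩, ⟨0, hn⟩)⟩
  have h := bernExp_mono h0 h1 (supError_le (p := p) ht)
  rw [bernExp_add, bernExp_const_mul] at h
  have h2 := bernExp_abs_sum_le h0 h1
  have h3 := mul_le_mul_of_nonneg_left (bernExp_opNorm_le hm h0 h1) (by positivity : 0 ≤ 2 * t)
  simp only [Fintype.card_prod, Fintype.card_fin, Nat.cast_mul] at h2
  linarith

end SupError

/-! ### Reduction of the observation model to Bernoulli patterns -/

lemma shiftedLoss_eq {ρ : ℝ} (hρ : ρ < 1) (x a : ℝ) :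
    shiftedLoss ρ x a = x ^ 2 + (1 - 2 * x) / (1 - ρ) * (if a = 1 then 1 else 0) := by
  have : 1 - ρ ≠ 0 := by linarith
  unfold shiftedLoss
  split_ifs
  · field_simp
    ring
  · ring

section Model

variable {Ω : Type*} [MeasurableSpace Ω] {μ : Measure Ω} {m n : ℕ}
  {M : Matrix (Fin m) (Fin n) ℝ} {ρ : ℝ} {Y A : Ω → Matrix (Fin m) (Fin n) ℝ}

open Classical in
/-- The pattern of ones of a matrix. -/
noncomputable def onesPattern (B : Matrix (Fin m) (Fin n) ℝ) (q : Fin m × Fin n) : Bool :=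
  decide (B q.1 q.2 = 1)

lemma IsPUObservation.measurableSet_obs (h : IsPUObservation μ M ρ Y A) (i : Fin m) (j : Fin n) :
    MeasurableSet {ω | A ω i j = 1} :=
  h.measurable_obs i j (measurableSet_singleton 1)

variable [IsProbabilityMeasure μ]

lemma IsPUObservation.integral_shiftedLoss (h : IsPUObservation μ M ρ Y A) (hρ : ρ < 1)
    (i : Fin m) (j : Fin n) (x : ℝ) :
    Integrable (fun ω => shiftedLoss ρ x (A ω i j)) μ ∧
      ∫ ω, shiftedLoss ρ x (A ω i j) ∂μ = x ^ 2 + (1 - 2 * x) / (1 - ρ) * (M i j * (1 - ρ)) := by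
  have hi : (fun ω => if A ω i j = 1 then (1 : ℝ) else 0)
      = {ω | A ω i j = 1}.indicator 1 := by
    ext ω; simp [Set.indicator_apply]
  have hint : Integrable (fun ω => if A ω i j = 1 then (1 : ℝ) else 0) μ := by
    rw [hi]
    exact (integrable_const (1 : ℝ)).indicator (h.measurableSet_obs i j)
  simp_rw [shiftedLoss_eq hρ]
  refine ⟨(integrable_const _).add (hint.const_mul _), ?_⟩
  rw [integral_add (integrable_const _) (hint.const_mul _), integral_const_mul, hi,
    integral_indicator_one (h.measurableSet_obs i j), h.prob_obs]
  simp

lemma IsPUObservation.expectedError_sub_empiricalError (h : IsPUObservation μ M ρ Y A)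
    (hρ : ρ < 1) (X : Matrix (Fin m) (Fin n) ℝ) (ω : Ω) :
    expectedError μ ρ A X - empiricalError ρ X (A ω)
      = 1 / ((1 - ρ) * ((m : ℝ) * n)) *
        centeredError (fun q => M q.1 q.2 * (1 - ρ)) X (onesPattern (A ω)) := by
  have hexp : expectedError μ ρ A X = 1 / ((m : ℝ) * n) * ∑ i, ∑ j,
      ((X i j) ^ 2 + (1 - 2 * X i j) / (1 - ρ) * (M i j * (1 - ρ))) := by
    unfold expectedError empiricalError
    rw [integral_const_mul]
    congr 1
    refine (integral_finsetSum _ fun i _ => integrable_finsetSum _ fun j _ =>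
      (h.integral_shiftedLoss hρ i j _).1).trans (Finset.sum_congr rfl fun i _ => ?_)
    refine (integral_finsetSum _ fun j _ => (h.integral_shiftedLoss hρ i j _).1).trans ?_
    exact Finset.sum_congr rfl fun j _ => (h.integral_shiftedLoss hρ i j _).2
  have hsum : ∑ i, ∑ j, ((X i j) ^ 2 + (1 - 2 * X i j) / (1 - ρ) * (M i j * (1 - ρ)))
      - ∑ i, ∑ j, shiftedLoss ρ (X i j) (A ω i j) = 1 / (1 - ρ) *
        centeredError (fun q => M q.1 q.2 * (1 - ρ)) X (onesPattern (A ω)) := by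
    rw [centeredError, Fintype.sum_prod_type, Finset.mul_sum, ← Finset.sum_sub_distrib]
    refine Finset.sum_congr rfl fun i _ => ?_
    rw [Finset.mul_sum, ← Finset.sum_sub_distrib]
    refine Finset.sum_congr rfl fun j _ => ?_
    rw [shiftedLoss_eq hρ]
    simp only [onesPattern, decide_eq_true_eq]
    ring
  rw [hexp, empiricalError, ← mul_sub, hsum, ← mul_assoc, one_div_mul_one_div, mul_comm (1 - ρ)]

lemma IsPUObservation.measureReal_onesPattern_eq (h : IsPUObservation μ M ρ Y A)
    (a : Fin m × Fin n → Bool) :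
    μ.real {ω | onesPattern (A ω) = a} = bernWeight (fun q => M q.1 q.2 * (1 - ρ)) a := by
  let s : Fin m × Fin n → Set (ℝ × ℝ) := fun q => {z | z.2 = 1 ↔ a q = true}
  have hs : ∀ q, MeasurableSet (s q) := by
    intro q
    have : MeasurableSet {z : ℝ × ℝ | z.2 = 1} := measurable_snd (measurableSet_singleton 1)
    cases hq : a q
    · have hc : s q = {z : ℝ × ℝ | z.2 = 1}ᶜ := by ext z; simp [s, hq]
      rw [hc]
      exact this.compl
    · simpa [s, hq] using this
  have hset : {ω | onesPattern (A ω) = a} = ⋂ q ∈ Finset.univ,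
      (fun ω => (Y ω q.1 q.2, A ω q.1 q.2)) ⁻¹' s q := by
    ext ω
    simp only [s, Set.mem_ofPred_eq, funext_iff, Set.mem_iInter, Set.mem_preimage, onesPattern,
      Finset.mem_univ, true_imp_iff]
    refine forall_congr' fun q => ?_
    by_cases hA : A ω q.1 q.2 = 1 <;> cases a q <;> simp [hA]
  rw [hset, measureReal_def,
    h.indep.measure_inter_preimage_eq_mul Finset.univ fun q _ => hs q, ENNReal.toReal_prod,
    bernWeight]
  refine Finset.prod_congr rfl fun q _ => ?_
  cases hq : a q
  · have : (fun ω => (Y ω q.1 q.2, A ω q.1 q.2)) ⁻¹' s q = {ω | A ω q.1 q.2 = 1}ᶜ := by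
      ext ω; simp [s, hq]
    rw [this, ← measureReal_def, probReal_compl_eq_one_sub (h.measurableSet_obs _ _), h.prob_obs]
    simp
  · have : (fun ω => (Y ω q.1 q.2, A ω q.1 q.2)) ⁻¹' s q = {ω | A ω q.1 q.2 = 1} := by
      ext ω; simp [s, hq]
    rw [this, ← measureReal_def, h.prob_obs]
    simp

lemma IsPUObservation.one_sub_le_measureReal (h : IsPUObservation μ M ρ Y A)
    (G : (Fin m × Fin n → Bool) → Prop) [DecidablePred G] :
    1 - ∑ a with ¬ G a, bernWeight (fun q => M q.1 q.2 * (1 - ρ)) a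
      ≤ μ.real {ω | G (onesPattern (A ω))} := by
  have hcov : (Set.univ : Set Ω) ⊆ {ω | G (onesPattern (A ω))} ∪
      ⋃ a ∈ Finset.univ.filter fun a => ¬ G a, {ω | onesPattern (A ω) = a} := by
    intro ω _
    by_cases hG : G (onesPattern (A ω))
    · exact Or.inl hG
    · exact Or.inr (by simpa using hG)
  have h1 := (measureReal_mono (μ := μ) hcov).trans ((measureReal_union_le _ _).trans
    (add_le_add_right (measureReal_biUnion_finset_le _ _) _))
  simp_rw [h.measureReal_onesPattern_eq, probReal_univ] at h1
  linarith

end Model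

end PUMatrix

theorem mainTheorem3 :
    ∃ C : ℝ, 0 < C ∧
      ∀ (m n : ℕ), 0 < m → 0 < n →
      ∀ (M : Matrix (Fin m) (Fin n) ℝ), (∀ i j, 0 ≤ M i j ∧ M i j ≤ 1) →
      ∀ (ρ t δ : ℝ), 0 ≤ ρ → ρ < 1 → 0 ≤ t → 0 < δ → δ < 1 →
      ∀ {Ω : Type*} [MeasurableSpace Ω] (μ : Measure Ω) [IsProbabilityMeasure μ]
        (Y A : Ω → Matrix (Fin m) (Fin n) ℝ), PUMatrix.IsPUObservation μ M ρ Y A →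
        1 - δ ≤ μ.real {ω | ∀ X ∈ PUMatrix.hypothesisSpace m n t,
          |PUMatrix.expectedError μ ρ A X - PUMatrix.empiricalError ρ X (A ω)| ≤
            t * C * ((√(n : ℝ) + √(m : ℝ) + (PUMatrix.numOnes (Y ω) : ℝ) ^ (1 / 4 : ℝ))
                / ((1 - ρ) * ((m : ℝ) * (n : ℝ))))
              + 3 * (√(Real.log (2 / δ)) / (√((m : ℝ) * (n : ℝ)) * (1 - ρ)))} := by
  classical
  -- The 18 is 2, from the slope of `1 - 2X`, times 9, from `bernExp_opNorm_le`.
  refine ⟨18, by norm_num, ?_⟩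
  intro m n hm hn M hM ρ t δ hρ0 hρ1 ht hδ0 hδ1 Ω _ μ _ Y A h
  have : Nonempty (Fin m × Fin n) := ⟨(⟨0, hm⟩, ⟨0, hn⟩)⟩
  set p : Fin m × Fin n → ℝ := fun q => M q.1 q.2 * (1 - ρ) with hp
  have hρ : 0 < 1 - ρ := by linarith
  have h0 : ∀ q, 0 ≤ p q := fun q => mul_nonneg (hM _ _).1 hρ.le
  have h1 : ∀ q, p q ≤ 1 := fun q => mul_le_one₀ (hM _ _).2 hρ.le (by linarith)
  have hN : (0 : ℝ) < (m : ℝ) * n := by positivity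
  set N : ℝ := (m : ℝ) * n with hNdef
  set L : ℝ := Real.log (2 / δ) with hL
  -- This gives `√N ≤ 2 ε`, so the mean's `√N` and the deviation `ε` together fit in `3 ε`.
  have hL2 : 1 / 4 ≤ L := by
    have h3 : Real.log 2 ≤ L := Real.log_le_log (by norm_num)
      ((le_div_iff₀ hδ0).2 (by linarith))
    linarith [Real.log_two_gt_d9]
  have hsL : 1 / 2 ≤ √L := Real.le_sqrt_of_sq_le (by linarith)
  set ε : ℝ := √N * √L with hε
  have hε2 : ε ^ 2 = N * L := by
    rw [hε, mul_pow, Real.sq_sqrt hN.le, Real.sq_sqrt (by linarith)]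
  have htail := PUMatrix.sum_bernWeight_tail_le h0 h1
    (PUMatrix.hasBoundedDifferences_supError h0 h1 t) (ε := ε) (by positivity)
  -- The tail is `exp (-2 L) = (δ / 2) ^ 2`, at most `δ`.
  have htail_le : Real.exp (-(2 * ε ^ 2 / Fintype.card (Fin m × Fin n))) ≤ δ := by
    have hc : (Fintype.card (Fin m × Fin n) : ℝ) = N := by simp [hNdef]
    have hLe : -(2 * (N * L) / N) = -L + -L := by field_simp; ring
    have hexp : Real.exp (-L) = δ / 2 := by
      rw [Real.exp_neg, Real.exp_log (by positivity), inv_div]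
    rw [hc, hε2, hLe, Real.exp_add, hexp]
    nlinarith
  have hgood := h.one_sub_le_measureReal fun a =>
    PUMatrix.supError p t a ≤ PUMatrix.bernExp p (PUMatrix.supError p t) + ε
  -- Monotonicity suffices, so measurability of the target event is not required.
  refine le_trans (by linarith) (hgood.trans (measureReal_mono ?_))
  intro ω hω X hX
  have hsup := PUMatrix.abs_centeredError_le_supError h0 h1 hX (PUMatrix.onesPattern (A ω))
  have hE := PUMatrix.bernExp_supError_le hm hn h0 h1 ht
  have hs : 0 ≤ (PUMatrix.numOnes (Y ω) : ℝ) ^ (1 / 4 : ℝ) := by positivity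
  have hω' : PUMatrix.supError p t (PUMatrix.onesPattern (A ω))
    ≤ PUMatrix.bernExp p (PUMatrix.supError p t) + ε := hω
  have hsN : 0 < √N := Real.sqrt_pos.2 hN
  have hrhs : t * 18 * ((√(n : ℝ) + √(m : ℝ) + (PUMatrix.numOnes (Y ω) : ℝ) ^ (1 / 4 : ℝ))
      / ((1 - ρ) * N)) + 3 * (√L / (√N * (1 - ρ)))
      = 1 / ((1 - ρ) * N) * (t * 18 * (√(n : ℝ) + √(m : ℝ)
        + (PUMatrix.numOnes (Y ω) : ℝ) ^ (1 / 4 : ℝ)) + 3 * ε) := by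
    rw [hε]
    have : N = √N * √N := (Real.mul_self_sqrt hN.le).symm
    rw [this, Real.sqrt_mul_self hsN.le]
    field_simp
  rw [hrhs, h.expectedError_sub_empiricalError hρ1, abs_mul,
    abs_of_nonneg (by positivity : 0 ≤ 1 / ((1 - ρ) * N))]
  refine mul_le_mul_of_nonneg_left ?_ (by positivity)
  have hεN : √N ≤ 2 * ε := by rw [hε]; nlinarith
  have hts := mul_nonneg ht hs
  linarith
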